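/- Let $\mathcal K\subset\mathbb R^n$ be a proper cone (a closed, pointed, solid convex cone), let $\mathcal K^*=\{y:\ x^\top y\ge 0\ \ \forall x\in\mathcal K\}$ be its dual cone, and let $e_1,\dots,e_n$ be the standard basis of $\mathbb R^n$. A matrix $A\in\mathbb R^{n\times n}$ is *cross-positive* over $\mathcal K$ if $y^\top Ax\ge 0$ whenever $x\in\mathcal K$, $y\in\mathcal K^*$ and $y^\top x=0$; a cross-positive $A$ is *$\mathcal K$-irreducible* if no eigenvector of $A$ lies on the boundary of $\mathcal K$; a matrix $M$ is *$\mathcal K$-positive* if $M\mathcal K\subseteq\mathcal K$ and $M(\mathcal K\setminus\{0\})\subseteq\operatorname{int}\mathcal K$. The system $\dot x=Ax+bu$, $y=c^\top x$ (with $u(t),y(t)\in\mathbb R$) is *cone-invariant* over $\mathcal K$ if, for continuous inputs $u$, $x(0)\in\mathcal K$ and $u(t)\ge 0$ for all $t\ge 0$ imply $x(t)\in\mathcal K$ and $y(t)\ge 0$ for all $t\ge 0$. For an attack vector $b\in\mathbb R^n$ and a sensor vector $c\in\mathbb R^n$, an attack signal $d:[0,\infty)\to\mathbb R$ is *undetectable*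 if for some initial state the output $y=c^\top x$ of $\dot x=Ax+bd$ vanishes for all $t\ge 0$. The sensor $c$ is a *successful defense* against attacks entering through $b$ if for each $s_0\ge 0$ the matrix $$R(s_0)=\begin{bmatrix}s_0I-A&b\\ c^\top&0\end{bmatrix}$$ either has rank $n+1$, or has rank less than $n+1$ and every $(\zeta,d_0)\in\mathbb R^n\times\mathbb R$ in its kernel has $d_0=0$. **Theorem.** Let $\dot x=Ax+bu$, $y=c^\top x$ be a cone-invariant system over $\mathcal K$ whose matrix $A$ is Hurwitz stable (all eigenvalues have negative real part). 1. For every $e_i\in\mathcal K$ and every $e_j\in\operatorname{int}\mathcal K^*$, the single sensor $e_j$ is a successful defense against attacks entering through $e_i$. Moreover, for every $s_0\ge 0$, $s_0I-A$ is invertible, $e_j^\top(s_0I-A)^{-1}e_i>0$, and (for attack vector $e_i$ and sensor $e_j$) no attack $d(t)=-e^{s_0t}d_0$ with $d_0\in\mathbb R\setminus\{0\}$ is undetectable. 2. If in addition $A$ is cross-positive over $\mathcal K$ and $\mathcal K$-irreducible, then all conclusions of part 1 hold for every $e_i\in\mathcal K$ and every $e_j\in\mathcal K^*$, and $(s_0I-A)^{-1}$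 is $\mathcal K$-positive for every $s_0\ge 0$. -/

import Mathlib

open Matrix Set

/-- The dual cone `K* = {y | ⟨x, y⟩ ≥ 0 for all x ∈ K}` for the standard inner product
`⟨x, y⟩ = xᵀ y` of `ℝⁿ`. -/
def dualCone {n : ℕ} (K : Set (Fin n → ℝ)) : Set (Fin n → ℝ) :=
  {y | ∀ x ∈ K, 0 ≤ x ⬝ᵥ y}

/-- A proper cone of `ℝⁿ`: a closed convex cone containing `0` (this is what Mathlib's `ProperCone`
bundles) that moreover is pointed, `K ∩ -K = {0}`, and solid, i.e. has nonempty interior. -/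
structure IsPointedSolid {n : ℕ} (K : ProperCone ℝ (Fin n → ℝ)) : Prop where
  pointed : ∀ x ∈ K, -x ∈ K → x = 0
  solid : (interior (K : Set (Fin n → ℝ))).Nonempty

/-- `A` is `K`-invariant: `A K ⊆ K`. -/
def IsConeInvariantMatrix {n : ℕ} (K : ProperCone ℝ (Fin n → ℝ))
    (A : Matrix (Fin n) (Fin n) ℝ) : Prop :=
  ∀ x ∈ K, A *ᵥ x ∈ K

/-- `A` is `K`-positive: it is `K`-invariant and maps `K \ {0}` into the interior of `K`. -/
def IsConePositive {n : ℕ} (K : ProperCone ℝ (Fin n → ℝ))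
    (A : Matrix (Fin n) (Fin n) ℝ) : Prop :=
  IsConeInvariantMatrix K A ∧ ∀ x ∈ K, x ≠ 0 → A *ᵥ x ∈ interior (K : Set (Fin n → ℝ))

/-- `A` is cross-positive over `K`. -/
def IsCrossPositive {n : ℕ} (K : ProperCone ℝ (Fin n → ℝ))
    (A : Matrix (Fin n) (Fin n) ℝ) : Prop :=
  ∀ x ∈ K, ∀ y ∈ dualCone (K : Set (Fin n → ℝ)), y ⬝ᵥ x = 0 → 0 ≤ y ⬝ᵥ (A *ᵥ x)

/-- `A` is a `K`-irreducible cross-positive matrix: it is cross-positive over `K`, and no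
eigenvector of `A` lies on the boundary of `K`. -/
structure IsConeIrreducible {n : ℕ} (K : ProperCone ℝ (Fin n → ℝ))
    (A : Matrix (Fin n) (Fin n) ℝ) : Prop where
  crossPositive : IsCrossPositive K A
  no_boundary_eigenvector : ∀ (x : Fin n → ℝ) (r : ℝ), x ≠ 0 → A *ᵥ x = r • x →
    x ∉ frontier (K : Set (Fin n → ℝ))

/-- `A` is Hurwitz stable: every complex eigenvalue has negative real part. -/
def IsHurwitz {n : ℕ} (A : Matrix (Fin n) (Fin n) ℝ) : Prop :=
  ∀ z ∈ spectrum ℂ (A.map (algebraMap ℝ ℂ)), z.re < 0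

/-- `x` is a (state) trajectory on `[0, ∞)` of `ẋ(t) = A x(t) + b u(t)`. -/
def IsTrajectory {n : ℕ} (A : Matrix (Fin n) (Fin n) ℝ) (b : Fin n → ℝ)
    (u : ℝ → ℝ) (x : ℝ → Fin n → ℝ) : Prop :=
  ∀ t, 0 ≤ t → HasDerivWithinAt x (A *ᵥ x t + u t • b) (Ici 0) t

/-- The system `ẋ = A x + b u`, `y = cᵀ x` is cone-invariant over `K`: if `x(0) ∈ K` and
`u(t) ≥ 0` for `t ≥ 0` (`u` a continuous input), then `x(t) ∈ K` and `y(t) ≥ 0` for `t ≥ 0`. -/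
def IsConeInvariantSystem {n : ℕ} (K : ProperCone ℝ (Fin n → ℝ))
    (A : Matrix (Fin n) (Fin n) ℝ) (b c : Fin n → ℝ) : Prop :=
  ∀ (u : ℝ → ℝ) (x : ℝ → Fin n → ℝ), ContinuousOn u (Ici 0) → (∀ t, 0 ≤ t → 0 ≤ u t) →
    IsTrajectory A b u x → x 0 ∈ K → ∀ t, 0 ≤ t → x t ∈ K ∧ 0 ≤ c ⬝ᵥ x t

/-- The attack `d` on `ẋ = A x + b d`, `y = cᵀ x` is undetectable: for some actual initial state
`x₀` and attack initial condition `x₁`, the output generated by the initial state `x₀ - x₁`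
and the input `d` vanishes for all `t ≥ 0`. -/
def IsUndetectable {n : ℕ} (A : Matrix (Fin n) (Fin n) ℝ) (b c : Fin n → ℝ)
    (d : ℝ → ℝ) : Prop :=
  ∃ (x₀ x₁ : Fin n → ℝ) (x : ℝ → Fin n → ℝ),
    x 0 = x₀ - x₁ ∧ IsTrajectory A b d x ∧ ∀ t, 0 ≤ t → c ⬝ᵥ x t = 0

/-- The Rosenbrock system matrix `[s I - A, b; cᵀ, 0]`. -/
def rosenbrock {n : ℕ} (A : Matrix (Fin n) (Fin n) ℝ) (b c : Fin n → ℝ) (s : ℝ) :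
    Matrix (Fin n ⊕ Unit) (Fin n ⊕ Unit) ℝ :=
  fromBlocks (s • (1 : Matrix (Fin n) (Fin n) ℝ) - A) (replicateCol Unit b) (replicateRow Unit c) 0

/-- The defense strategy `c` is successful against attacks entering through `b`: for each `s ≥ 0`,
either the Rosenbrock matrix has full rank `n + 1`, or it is rank-deficient but every vector
`(ζ, d₀)` in its kernel has `d₀ = 0`, so that the attack `-exp (s t) d₀` vanishes. -/
def IsSuccessfulDefense {n : ℕ} (A : Matrix (Fin n) (Fin n) ℝ) (b c : Fin n → ℝ) : Prop :=
  ∀ s : ℝ, 0 ≤ s →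
    (rosenbrock A b c s).rank = n + 1 ∨
    ((rosenbrock A b c s).rank < n + 1 ∧
      ∀ (ζ : Fin n → ℝ) (d₀ : ℝ),
        rosenbrock A b c s *ᵥ Sum.elim ζ (fun _ => d₀) = 0 → d₀ = 0)

/-- The sensor `c` blocks every real zero-dynamics attack with `s ≥ 0` entering through `b`:
the defense is successful, and for each `s ≥ 0` the matrix `s I - A` is invertible,
`cᵀ (s I - A)⁻¹ b > 0`, and no attack `d(t) = -exp (s t) d₀` with `d₀ ≠ 0` is undetectable. -/
structure BlocksAttacks {n : ℕ} (A : Matrix (Fin n) (Fin n) ℝ) (b c : Fin n → ℝ) : Prop where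
  successful : IsSuccessfulDefense A b c
  transfer_pos : ∀ s : ℝ, 0 ≤ s → IsUnit (s • (1 : Matrix (Fin n) (Fin n) ℝ) - A) ∧
    0 < c ⬝ᵥ ((s • (1 : Matrix (Fin n) (Fin n) ℝ) - A)⁻¹ *ᵥ b)
  no_undetectable : ∀ s d₀ : ℝ, 0 ≤ s → d₀ ≠ 0 →
    ¬ IsUndetectable A b c (fun t => -(Real.exp (s * t) * d₀))

/-! ### Orbits of a linear flow, discounted by an exponential -/

section Flow

open NormedSpace Filter Topology

variable {E : Type*} [NormedAddCommGroup E] [NormedSpace ℝ E] [CompleteSpace E]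

/-! Everything reduces to positivity of the transfer value `cᵀ(sI - A)⁻¹b`. It makes the Rosenbrock
matrix invertible, and an undetectable attack `-exp(st)d₀` would force `s` to be an eigenvalue of
`A`.

With zero input, cone-invariance says that the flow of `A` preserves `K`. For `s > ‖A‖` the
resolvent is a Laplace transform of the flow, so it preserves `K`; a Neumann series inside the cone
carries this down to every `s ≥ 0`, as stability excludes eigenvalues there (`resolvent_mem_cone`).
A functional interior to the dual cone is then positive on the nonzero vector `(sI - A)⁻¹b`.

In the irreducible case, suppose `z = (sI - A)⁻¹x` is on the boundary. A supporting functional at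
`z` vanishes along the whole orbit of `x`, so `x` lies in a resolvent-invariant closed subcone of
the boundary. By a Perron-Frobenius argument that subcone contains an eigenvector, a contradiction
(`resolvent_mem_interior_cone`). -/

theorem hasDerivAt_exp_smul_apply (T : E →L[ℝ] E) (x : E) (t : ℝ) :
    HasDerivAt (fun t : ℝ => exp (t • T) x) (exp (t • T) (T x)) t :=
  by simpa using (hasDerivAt_exp_smul_const T t).clm_apply (hasDerivAt_const t x)

theorem hasDerivAt_exp_smul_apply' (T : E →L[ℝ] E) (x : E) (t : ℝ) :
    HasDerivAt (fun t : ℝ => exp (t • T) x) (T (exp (t • T) x)) t :=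
  by simpa using (hasDerivAt_exp_smul_const' T t).clm_apply (hasDerivAt_const t x)

theorem norm_exp_smul_apply_le (T : E →L[ℝ] E) (x : E) {t : ℝ} (ht : 0 ≤ t) :
    ‖exp (t • T) x‖ ≤ ‖x‖ * Real.exp (‖T‖ * t) := by
  have h := norm_le_gronwallBound_of_norm_deriv_right_le
    (f := fun t : ℝ => exp (t • T) x) (f' := fun t : ℝ => T (exp (t • T) x))
    (δ := ‖x‖) (K := ‖T‖) (ε := 0) (a := 0) (b := t)
    (fun s _ => (hasDerivAt_exp_smul_apply' T x s).continuousAt.continuousWithinAt)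
    (fun s _ => (hasDerivAt_exp_smul_apply' T x s).hasDerivWithinAt)
    (by simp) (fun s _ => by simpa using T.le_opNorm _) t ⟨ht, le_rfl⟩
  simpa [gronwallBound_ε0] using h

/-- If `(s - T) z = x`, the discounted orbit of `z` has derivative minus that of `x`. -/
theorem hasDerivAt_discounted (T : E →L[ℝ] E) (f : E →L[ℝ] ℝ) {s : ℝ} {x z : E}
    (hz : s • z - T z = x) (t : ℝ) :
    HasDerivAt (fun t : ℝ => Real.exp (-(s * t)) * f (exp (t • T) z))
      (-(Real.exp (-(s * t)) * f (exp (t • T) x))) t := by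
  have h1 : HasDerivAt (fun t : ℝ => Real.exp (-(s * t))) (Real.exp (-(s * t)) * -(s * 1)) t :=
    (((hasDerivAt_id t).const_mul s).neg).exp
  have h2 : HasDerivAt (fun t : ℝ => f (exp (t • T) z)) (f (exp (t • T) (T z))) t :=
    f.hasFDerivAt.comp_hasDerivAt t (hasDerivAt_exp_smul_apply T z t)
  refine (h1.mul h2).congr_deriv ?_
  rw [← hz]
  simp only [map_sub, map_smul, smul_eq_mul]
  ring

theorem antitoneOn_discounted (T : E →L[ℝ] E) (f : E →L[ℝ] ℝ) {s : ℝ} {x z : E}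
    (hz : s • z - T z = x) (hx : ∀ t : ℝ, 0 ≤ t → 0 ≤ f (exp (t • T) x)) :
    AntitoneOn (fun t : ℝ => Real.exp (-(s * t)) * f (exp (t • T) z)) (Ici 0) := by
  refine antitoneOn_of_hasDerivWithinAt_nonpos (convex_Ici 0)
    (fun t _ => (hasDerivAt_discounted T f hz t).continuousAt.continuousWithinAt)
    (fun t _ => (hasDerivAt_discounted T f hz t).hasDerivWithinAt) fun t ht => ?_
  rw [interior_Ici] at ht
  have := hx t (le_of_lt ht)
  have := (Real.exp_pos (-(s * t))).le
  nlinarith [mul_nonneg ‹0 ≤ Real.exp (-(s * t))› ‹0 ≤ f (exp (t • T) x)›]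

/-- The discounted orbit of `z` is nonincreasing and, since the flow grows at most like `exp(‖T‖t)`,
tends to `0`; hence it is nonnegative. This replaces the Laplace integral. -/
theorem nonneg_orbit_resolvent (T : E →L[ℝ] E) (f : E →L[ℝ] ℝ) {s : ℝ} (hs : ‖T‖ < s) {x z : E}
    (hz : s • z - T z = x) (hx : ∀ t : ℝ, 0 ≤ t → 0 ≤ f (exp (t • T) x)) {t : ℝ} (ht : 0 ≤ t) :
    0 ≤ f (exp (t • T) z) := by
  have hanti := antitoneOn_discounted T f hz hx
  have hlim : Tendsto (fun t : ℝ => Real.exp (-(s * t)) * f (exp (t • T) z)) atTop (𝓝 0) := by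
    have hb : Tendsto (fun t : ℝ => ‖f‖ * ‖z‖ * Real.exp (-((s - ‖T‖) * t))) atTop (𝓝 0) := by
      have : Tendsto (fun t : ℝ => Real.exp (-((s - ‖T‖) * t))) atTop (𝓝 0) :=
        Real.tendsto_exp_neg_atTop_nhds_zero.comp
          (tendsto_id.const_mul_atTop (sub_pos.2 hs))
      simpa using this.const_mul (‖f‖ * ‖z‖)
    refine squeeze_zero_norm' ?_ hb
    filter_upwards [eventually_ge_atTop 0] with t ht
    rw [norm_mul, Real.norm_of_nonneg (Real.exp_pos _).le]
    calc Real.exp (-(s * t)) * ‖f (exp (t • T) z)‖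
        ≤ Real.exp (-(s * t)) * (‖f‖ * (‖z‖ * Real.exp (‖T‖ * t))) := by
          gcongr
          exact (f.le_opNorm _).trans (by gcongr; exact norm_exp_smul_apply_le T z ht)
      _ = ‖f‖ * ‖z‖ * Real.exp (-((s - ‖T‖) * t)) := by
          rw [show -((s - ‖T‖) * t) = -(s * t) + ‖T‖ * t by ring, Real.exp_add]; ring
  have h0 : 0 ≤ Real.exp (-(s * t)) * f (exp (t • T) z) := by
    refine le_of_tendsto hlim ?_
    filter_upwards [eventually_ge_atTop t] with r hr
    exact hanti ht (ht.trans hr : (0 : ℝ) ≤ r) hr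
  exact (mul_nonneg_iff_of_pos_left (Real.exp_pos _)).1 h0

/-- If a functional is nonnegative along the orbits of `x` and of its resolvent image `z`, and
vanishes at `z`, then it vanishes along the orbit of `x`. -/
theorem orbit_eq_zero_of_resolvent_eq_zero (T : E →L[ℝ] E) (f : E →L[ℝ] ℝ) {s : ℝ} {x z : E}
    (hz : s • z - T z = x) (hx : ∀ t : ℝ, 0 ≤ t → 0 ≤ f (exp (t • T) x))
    (hzf : ∀ t : ℝ, 0 ≤ t → 0 ≤ f (exp (t • T) z)) (hf : f z = 0) {t : ℝ} (ht : 0 ≤ t) :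
    f (exp (t • T) x) = 0 := by
  have hanti := antitoneOn_discounted T f hz hx
  have hzero : ∀ r ∈ Ici (0 : ℝ), Real.exp (-(s * r)) * f (exp (r • T) z) = 0 := by
    intro r hr
    refine le_antisymm ?_ (mul_nonneg (Real.exp_pos _).le (hzf r hr))
    have := hanti (mem_Ici.2 le_rfl) hr hr
    simpa [hf] using this
  have h1 := (hasDerivAt_discounted T f hz t).hasDerivWithinAt (s := Ici 0)
  have h2 : HasDerivWithinAt (fun r : ℝ => Real.exp (-(s * r)) * f (exp (r • T) z)) 0 (Ici 0) t :=
    (hasDerivWithinAt_const t (Ici 0) (0 : ℝ)).congr hzero (hzero t ht)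
  have h3 := (uniqueDiffOn_Ici (0 : ℝ) t ht).eq_deriv _ h1 h2
  have h4 := (Real.exp_pos (-(s * t))).ne'
  simpa [h4] using h3

end Flow

/-! ### Resolvent equations and eigenvectors in a closed cone -/

section Cone

open Filter Topology

variable {E : Type*} [NormedAddCommGroup E] [NormedSpace ℝ E] [FiniteDimensional ℝ E]

theorem exists_norm_le_of_no_eigenvector (C : ProperCone ℝ E) (T : E →L[ℝ] E) (a b : ℝ)
    (h : ∀ r ∈ Icc a b, ∀ z ∈ C, T z = r • z → z = 0) :
    ∃ m > 0, ∀ r ∈ Icc a b, ∀ z ∈ C, m * ‖z‖ ≤ ‖r • z - T z‖ := by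
  have : ProperSpace E := FiniteDimensional.proper ℝ E
  have hcomp : IsCompact (Icc a b ×ˢ ((C : Set E) ∩ Metric.sphere 0 1)) :=
    isCompact_Icc.prod ((isCompact_sphere (0 : E) 1).inter_left C.isClosed)
  have hcont : Continuous fun p : ℝ × E => ‖p.1 • p.2 - T p.2‖ := by fun_prop
  obtain ⟨m, hm, hle⟩ : ∃ m > 0, ∀ p ∈ Icc a b ×ˢ ((C : Set E) ∩ Metric.sphere 0 1),
      m ≤ ‖p.1 • p.2 - T p.2‖ := by
    -- A positive continuous function on a compact set is bounded away from `0`; homogeneity then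
    -- removes the normalization.
    refine hcomp.exists_forall_le' hcont.continuousOn fun p hp => ?_
    rw [norm_pos_iff, sub_ne_zero]
    intro he
    have hp0 := h p.1 hp.1 p.2 hp.2.1 he.symm
    have := hp.2.2
    simp [hp0] at this
  refine ⟨m, hm, fun r hr z hz => ?_⟩
  rcases eq_or_ne z 0 with rfl | hz0
  · simp
  have hn : 0 < ‖z‖ := norm_pos_iff.2 hz0
  have hw := hle (r, ‖z‖⁻¹ • z) ⟨hr, C.smul_mem hz (inv_nonneg.2 hn.le), by
    simp [norm_smul, hn.ne']⟩
  have he : r • (‖z‖⁻¹ • z) - T (‖z‖⁻¹ • z) = ‖z‖⁻¹ • (r • z - T z) := by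
    rw [map_smul, smul_sub, smul_comm]
  simp only [he, norm_smul, norm_inv, norm_norm] at hw
  rwa [← div_eq_inv_mul, le_div_iff₀ hn] at hw

/-- A Neumann series argument inside a closed cone: no linearity of the solution is needed. -/
theorem cone_solvable_sub (C : ProperCone ℝ E) (T : E →L[ℝ] E) {m r h : ℝ} (hm : 0 < m)
    (hbound : ∀ z ∈ C, m * ‖z‖ ≤ ‖r • z - T z‖) (h0 : 0 ≤ h) (hh : h < m)
    (hsol : ∀ x ∈ C, ∃ z ∈ C, r • z - T z = x) :
    ∀ x ∈ C, ∃ z ∈ C, (r - h) • z - T z = x := by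
  choose! S hSC hS using hsol
  intro x hx
  -- Formally `z k = h^k (r - T)^{-(k+1)} x`, the terms of the expansion of `(r - h - T)⁻¹ x`; their
  -- norms decay with ratio `h / m`.
  let z : ℕ → E := fun k => Nat.rec (S x) (fun _ w => S (h • w)) k
  have hz0 : z 0 = S x := rfl
  have hzs : ∀ k, z (k + 1) = S (h • z k) := fun k => rfl
  have hzC : ∀ k, z k ∈ C := by
    intro k
    induction k with
    | zero => exact hSC x hx
    | succ k ih => exact hSC _ (C.smul_mem ih h0)
  have hstep : ∀ k, r • z (k + 1) - T (z (k + 1)) = h • z k := fun k =>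
    hS _ (C.smul_mem (hzC k) h0)
  have hsum : Summable z := by
    refine summable_of_ratio_norm_eventually_le (r := h / m) ((div_lt_one hm).2 hh)
      (Eventually.of_forall fun k => ?_)
    have := hbound _ (hzC (k + 1))
    rw [hstep, norm_smul, Real.norm_of_nonneg h0] at this
    rw [div_mul_eq_mul_div, le_div_iff₀ hm]
    linarith
  refine ⟨∑' k, z k, ?_, ?_⟩
  · exact C.isClosed.mem_of_tendsto hsum.hasSum.tendsto_sum_nat
      (Eventually.of_forall fun N => C.sum_mem fun k _ => hzC k)
  · let L : E →L[ℝ] E := r • ContinuousLinearMap.id ℝ E - T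
    have hL : ∀ w, L w = r • w - T w := fun w => rfl
    have h1 : L (∑' k, z k) = x + h • ∑' k, z k := by
      rw [L.map_tsum hsum, (L.summable hsum).tsum_eq_zero_add, hL, hz0, hS x hx,
        ← tsum_const_smul'']
      congr 1
      exact tsum_congr fun k => hstep k
    rw [hL] at h1
    rw [sub_smul, sub_right_comm, h1, add_sub_cancel_right]

/-- Solvability of `(r - T) z = x` inside a closed cone propagates downwards in `r` as long as no
eigenvector of `T` lies in the cone. -/
theorem cone_solvable_of_le (C : ProperCone ℝ E) (T : E →L[ℝ] E) {a b : ℝ} (hab : a ≤ b)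
    (h : ∀ r ∈ Icc a b, ∀ z ∈ C, T z = r • z → z = 0)
    (hsol : ∀ x ∈ C, ∃ z ∈ C, b • z - T z = x) :
    ∀ x ∈ C, ∃ z ∈ C, a • z - T z = x := by
  obtain ⟨m, hm, hbound⟩ := exists_norm_le_of_no_eigenvector C T a b h
  -- The bound `m` is uniform on `[a, b]`, so finitely many steps of length `(b - a) / N < m`
  -- suffice.
  obtain ⟨N, hN⟩ := exists_nat_gt ((b - a) / m)
  have hN0 : (0 : ℝ) < N := (div_nonneg (sub_nonneg.2 hab) hm.le).trans_lt hN
  have hδ0 : 0 ≤ (b - a) / N := div_nonneg (sub_nonneg.2 hab) hN0.le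
  have hδm : (b - a) / N < m := by
    rw [div_lt_iff₀ hm] at hN
    rw [div_lt_iff₀ hN0]
    linarith
  have key : ∀ k : ℕ, k ≤ N → ∀ x ∈ C, ∃ z ∈ C, (b - k * ((b - a) / N)) • z - T z = x := by
    intro k
    induction k with
    | zero => simpa using hsol
    | succ k ih =>
      intro hk
      have hkN : (k : ℝ) * ((b - a) / N) ≤ b - a := by
        have : (k : ℝ) ≤ N := by exact_mod_cast (Nat.le_of_succ_le hk)
        calc (k : ℝ) * ((b - a) / N) ≤ N * ((b - a) / N) := by gcongr
          _ = b - a := mul_div_cancel₀ _ hN0.ne'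
      have hk0 : 0 ≤ (k : ℝ) * ((b - a) / N) := by positivity
      have := cone_solvable_sub C T hm
        (hbound (b - k * ((b - a) / N)) ⟨by linarith, by linarith⟩) hδ0 hδm
        (ih (Nat.le_of_succ_le hk))
      rwa [show b - ((k + 1 : ℕ) : ℝ) * ((b - a) / N) = b - k * ((b - a) / N) - (b - a) / N by
        push_cast; ring]
  have := key N le_rfl
  rwa [mul_div_cancel₀ _ hN0.ne', sub_sub_cancel] at this

/-- A Perron-Frobenius statement: if `(b - T) z = x` is solvable in the pointed closed cone `C`
for each `x ∈ C`, and `C ≠ 0`, then `C` contains an eigenvector of `T`. -/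
theorem exists_eigenvector_mem_cone (C : ProperCone ℝ E) (T : E →L[ℝ] E)
    (hC : ∀ x ∈ C, -x ∈ C → x = 0) {x : E} (hx : x ∈ C) (hx0 : x ≠ 0) {b : ℝ}
    (hsol : ∀ x ∈ C, ∃ z ∈ C, b • z - T z = x) :
    ∃ z ∈ C, z ≠ 0 ∧ ∃ r : ℝ, T z = r • z := by
  by_contra! hno
  have hsolve : ∀ s : ℝ, s ≤ b → ∃ z ∈ C, s • z - T z = x := fun s hs =>
    cone_solvable_of_le C T hs
      (fun r _ z hz he => by_contra fun hz0 => hno z hz hz0 r he) hsol x hx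
  have hev : ∀ᶠ N : ℝ in atTop, ∃ z ∈ C, -N • z - T z = x := by
    filter_upwards [eventually_ge_atTop (-b)] with N hN
    exact hsolve (-N) (by linarith)
  -- Without eigenvectors the equation stays solvable at `-N` for all large `N`. Then `N • z = -x -
  -- T z` with `T z → 0`, so closedness puts `-x` in `C`, against pointedness.
  have hmem : -x ∈ C := by
    refine C.isClosed.closure_subset (Metric.mem_closure_iff.2 fun ε hε => ?_)
    have hlim : Tendsto (fun N : ℝ => ‖T‖ * (‖x‖ / (N - ‖T‖))) atTop (𝓝 0) := by
      have h1 : Tendsto (fun N : ℝ => N - ‖T‖) atTop atTop :=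
        tendsto_atTop_add_const_right _ _ tendsto_id
      simpa using (h1.const_div_atTop ‖x‖).const_mul ‖T‖
    obtain ⟨N, ⟨z, hz, he⟩, hN, hNε⟩ := (hev.and
      ((eventually_gt_atTop ‖T‖).and (hlim.eventually_lt_const hε))).exists
    have hN0 : 0 ≤ N := (norm_nonneg T).trans hN.le
    refine ⟨N • z, C.smul_mem hz hN0, ?_⟩
    have hNz : N • z = -x - T z := by rw [← he, neg_smul]; abel
    have hT := T.le_opNorm z
    have hzle : ‖z‖ ≤ ‖x‖ / (N - ‖T‖) := by
      rw [le_div_iff₀ (sub_pos.2 hN)]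
      have h1 : N * ‖z‖ ≤ ‖x‖ + ‖T z‖ := by
        calc N * ‖z‖ = ‖N • z‖ := by rw [norm_smul, Real.norm_of_nonneg hN0]
          _ ≤ ‖x‖ + ‖T z‖ := by rw [hNz]; simpa using norm_sub_le (-x) (T z)
      linarith
    rw [hNz, dist_eq_norm, sub_sub_cancel]
    calc ‖T z‖ ≤ ‖T‖ * ‖z‖ := hT
      _ ≤ ‖T‖ * (‖x‖ / (N - ‖T‖)) := by gcongr
      _ < ε := hNε
  exact hx0 (hC x hx hmem)

end Cone

theorem exists_supporting_functional {E : Type*} [NormedAddCommGroup E] [NormedSpace ℝ E]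
    (C : ProperCone ℝ E)
    (hC : (interior (C : Set E)).Nonempty) {z : E} (hz : z ∈ C) (hzi : z ∉ interior (C : Set E)) :
    ∃ f : E →L[ℝ] ℝ, f ≠ 0 ∧ (∀ x ∈ C, 0 ≤ f x) ∧ f z = 0 := by
  obtain ⟨f, hf⟩ := geometric_hahn_banach_open_point C.convex.interior isOpen_interior hzi
  have hle : ∀ x ∈ C, f x ≤ f z := by
    intro x hx
    have hcl : x ∈ closure (interior (C : Set E)) := by
      rw [C.convex.closure_interior_eq_closure_of_nonempty_interior hC]
      exact subset_closure hx
    exact closure_minimal (fun a ha => (hf a ha).le) (isClosed_le f.continuous continuous_const) hcl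
  have hz0 : f z = 0 := by
    refine le_antisymm ?_ (by simpa using hle 0 C.zero_mem)
    -- Since `2z` is in the cone, `2 f z ≤ f z`.
    have := hle _ (C.smul_mem hz (zero_le_two (α := ℝ)))
    rw [map_smul, smul_eq_mul] at this
    linarith
  refine ⟨-f, ?_, fun x hx => ?_, by simp [hz0]⟩
  · rintro h0
    obtain ⟨a, ha⟩ := hC
    have h1 := hf a ha
    rw [neg_eq_zero.1 h0] at h1
    simp at h1
  · exact neg_nonneg.2 ((hle x hx).trans_eq hz0)

/-! ### Invariance and strict positivity of the resolvent -/

section Resolvent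

open NormedSpace

variable {E : Type*} [NormedAddCommGroup E] [NormedSpace ℝ E]

/-- The part of a closed cone on which a functional vanishes along all forward orbits. -/
def orbitFace (K : ProperCone ℝ E) (T : E →L[ℝ] E) (f : E →L[ℝ] ℝ) : ProperCone ℝ E where
  carrier := {x | x ∈ K ∧ ∀ t : ℝ, 0 ≤ t → f (exp (t • T) x) = 0}
  add_mem' := fun ha hb => ⟨K.add_mem ha.1 hb.1, fun t ht => by
    rw [map_add, map_add, ha.2 t ht, hb.2 t ht, add_zero]⟩
  zero_mem' := ⟨K.zero_mem, fun t _ => by simp⟩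
  smul_mem' := fun c x hx => ⟨K.smul_mem hx.1 c.2, fun t ht => by
    have h : exp (t • T) (c • x) = (c : ℝ) • exp (t • T) x := map_smul (exp (t • T)) (c : ℝ) x
    rw [h, map_smul, hx.2 t ht, smul_zero]⟩
  isClosed' := by
    refine K.isClosed.inter (s₂ := {x | ∀ t : ℝ, 0 ≤ t → f (exp (t • T) x) = 0}) ?_
    simp only [ofPred_forall]
    exact isClosed_iInter fun t => isClosed_iInter fun _ =>
      isClosed_eq (f.continuous.comp (exp (t • T)).continuous) continuous_const

theorem notMem_interior_of_functional_eq_zero {K : Set E} {f : E →L[ℝ] ℝ} (hf0 : f ≠ 0)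
    (hf : ∀ x ∈ K, 0 ≤ f x) {z : E} (hz : f z = 0) : z ∉ interior K := by
  intro hzi
  have hmin : IsLocalMin f z := by
    filter_upwards [mem_interior_iff_mem_nhds.1 hzi] with x hx
    rw [hz]
    exact hf x hx
  exact hf0 (hmin.hasFDerivAt_eq_zero f.hasFDerivAt)

variable [FiniteDimensional ℝ E]

theorem resolvent_mem_cone (K : ProperCone ℝ E) (T : E →L[ℝ] E)
    (hflow : ∀ x ∈ K, ∀ t : ℝ, 0 ≤ t → exp (t • T) x ∈ K)
    (hres : ∀ s : ℝ, 0 ≤ s → ∀ x, ∃ z, s • z - T z = x)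
    (hinj : ∀ s : ℝ, 0 ≤ s → ∀ z, T z = s • z → z = 0)
    {s : ℝ} (hs : 0 ≤ s) {x z : E} (hx : x ∈ K) (hz : s • z - T z = x) : z ∈ K := by
  have : CompleteSpace E := FiniteDimensional.complete ℝ E
  -- A starting point above both `‖T‖` and `s`; were `z` outside `K`, a separating functional would
  -- contradict `nonneg_orbit_resolvent` at time `0`.
  have hbase : ∀ x ∈ K, ∃ z ∈ K, (max s (‖T‖ + 1)) • z - T z = x := by
    intro x hx
    obtain ⟨z, hz⟩ := hres (max s (‖T‖ + 1)) (hs.trans (le_max_left _ _)) x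
    refine ⟨z, ?_, hz⟩
    by_contra hzK
    obtain ⟨f, hf, hfz⟩ := K.hyperplane_separation_point hzK
    have := nonneg_orbit_resolvent T f ((lt_add_one _).trans_le (le_max_right _ _)) hz
      (fun t ht => hf _ (hflow x hx t ht)) le_rfl
    simp only [zero_smul, exp_zero, one_apply_eq_self] at this
    exact hfz.not_ge this
  obtain ⟨w, hw, hws⟩ := cone_solvable_of_le K T (le_max_left s (‖T‖ + 1))
    (fun r hr z _ he => hinj r (hs.trans hr.1) z he) hbase x hx
  have hzw : z - w = 0 := by
    refine hinj s hs _ ?_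
    have h := hz.trans hws.symm
    rw [map_sub, smul_sub, ← sub_eq_zero]
    rw [← sub_eq_zero] at h
    rw [← neg_eq_zero, ← h]
    abel
  rwa [sub_eq_zero.1 hzw]

theorem resolvent_mem_interior_cone (K : ProperCone ℝ E) (T : E →L[ℝ] E)
    (hpt : ∀ x ∈ K, -x ∈ K → x = 0) (hsolid : (interior (K : Set E)).Nonempty)
    (hflow : ∀ x ∈ K, ∀ t : ℝ, 0 ≤ t → exp (t • T) x ∈ K)
    (hres : ∀ s : ℝ, 0 ≤ s → ∀ x, ∃ z, s • z - T z = x)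
    (hinj : ∀ s : ℝ, 0 ≤ s → ∀ z, T z = s • z → z = 0)
    (hirr : ∀ (z : E) (r : ℝ), z ≠ 0 → T z = r • z → z ∉ frontier (K : Set E))
    {s : ℝ} (hs : 0 ≤ s) {x z : E} (hx : x ∈ K) (hx0 : x ≠ 0) (hz : s • z - T z = x) :
    z ∈ interior (K : Set E) := by
  have : CompleteSpace E := FiniteDimensional.complete ℝ E
  by_contra hzi
  have hzK := resolvent_mem_cone K T hflow hres hinj hs hx hz
  obtain ⟨f, hf0, hf, hfz⟩ := exists_supporting_functional K hsolid hzK hzi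
  have hxF : x ∈ orbitFace K T f := ⟨hx, fun t ht =>
    orbit_eq_zero_of_resolvent_eq_zero T f hz (fun t ht => hf _ (hflow x hx t ht))
      (fun t ht => hf _ (hflow z hzK t ht)) hfz ht⟩
  have hsol : ∀ x ∈ orbitFace K T f, ∃ z ∈ orbitFace K T f, (‖T‖ + 1) • z - T z = x := by
    intro x hx
    have hT : 0 ≤ ‖T‖ + 1 := by positivity
    obtain ⟨z, hz⟩ := hres (‖T‖ + 1) hT x
    refine ⟨z, ⟨resolvent_mem_cone K T hflow hres hinj hT hx.1 hz, fun t ht => ?_⟩, hz⟩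
    refine le_antisymm ?_
      (nonneg_orbit_resolvent T f (lt_add_one _) hz (fun t ht => (hx.2 t ht).ge) ht)
    -- On the orbit face both `f` and `-f` are nonnegative along orbits, so the resolvent preserves
    -- the vanishing of `f`.
    have := nonneg_orbit_resolvent T (-f) (lt_add_one _) hz
      (fun t ht => by simp [hx.2 t ht]) ht
    simpa using this
  obtain ⟨w, hw, hw0, r, hr⟩ := exists_eigenvector_mem_cone (orbitFace K T f) T
    (fun x hx hx' => hpt x hx.1 hx'.1) hxF hx0 hsol
  have hfw : f w = 0 := by simpa using hw.2 0 le_rfl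
  refine hirr w r hw0 hr ?_
  rw [K.isClosed.frontier_eq]
  exact ⟨hw.1, notMem_interior_of_functional_eq_zero hf0 hf hfw⟩

end Resolvent

/-! ### From a nonzero transfer value to blocked attacks -/

section ZeroDynamics

variable {n : ℕ}

theorem isUnit_smul_one_sub_of_isHurwitz {A : Matrix (Fin n) (Fin n) ℝ} (hA : IsHurwitz A)
    {s : ℝ} (hs : 0 ≤ s) : IsUnit (s • (1 : Matrix (Fin n) (Fin n) ℝ) - A) := by
  rw [← Algebra.algebraMap_eq_smul_one, ← spectrum.notMem_iff]
  intro hmem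
  have hroot := mem_spectrum_iff_isRoot_charpoly.1 hmem
  have hC : ((s : ℝ) : ℂ) ∈ spectrum ℂ (A.map (algebraMap ℝ ℂ)) := by
    rw [mem_spectrum_iff_isRoot_charpoly, Matrix.charpoly_map]
    exact hroot.map
  exact (hA _ hC).not_ge (by simpa using hs)

/-- If an output of `ẇ = A w` equals `κ exp (s t)` with `κ ≠ 0`, then `s` is an eigenvalue. -/
theorem mem_spectrum_of_output_eq_exp (A : Matrix (Fin n) (Fin n) ℝ) (c : Fin n → ℝ)
    {w : ℝ → Fin n → ℝ} {s κ : ℝ} (hκ : κ ≠ 0)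
    (hw : ∀ t, 0 ≤ t → HasDerivWithinAt w (A *ᵥ w t) (Ici 0) t)
    (hc : ∀ t, 0 ≤ t → c ⬝ᵥ w t = κ * Real.exp (s * t)) : s ∈ spectrum ℝ A := by
  -- Each differentiation produces a factor `A` on the left and `s` on the right. Cayley-Hamilton
  -- then makes `s` a root of the characteristic polynomial.
  have hpow : ∀ k : ℕ, ∀ t, 0 ≤ t → c ⬝ᵥ ((A ^ k) *ᵥ w t) = s ^ k * (κ * Real.exp (s * t)) := by
    intro k
    induction k with
    | zero => simpa using hc
    | succ k ih =>
      intro t ht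
      let L : (Fin n → ℝ) →L[ℝ] ℝ :=
        LinearMap.toContinuousLinearMap (dotProductBilin ℝ ℝ c ∘ₗ (A ^ k).mulVecLin)
      have hL : ∀ v, L v = c ⬝ᵥ ((A ^ k) *ᵥ v) := fun v => rfl
      have h1 : HasDerivWithinAt (fun t => L (w t)) (L (A *ᵥ w t)) (Ici 0) t :=
        L.hasFDerivAt.comp_hasDerivWithinAt t (hw t ht)
      have h2 : HasDerivAt (fun t : ℝ => s ^ k * (κ * Real.exp (s * t)))
          (s ^ k * (κ * (Real.exp (s * t) * (s * 1)))) t :=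
        ((((hasDerivAt_id t).const_mul s).exp).const_mul κ).const_mul _
      have h3 := (uniqueDiffOn_Ici (0 : ℝ) t ht).eq_deriv _ h1
        (h2.hasDerivWithinAt.congr (fun r hr => ih r hr) (ih t ht))
      rw [hL, mulVec_mulVec, ← pow_succ] at h3
      rw [h3]
      ring
  have hpoly : ∀ p : Polynomial ℝ, c ⬝ᵥ ((Polynomial.aeval A p) *ᵥ w 0) = p.eval s * κ := by
    intro p
    induction p using Polynomial.induction_on' with
    | add p q hp hq => rw [map_add, add_mulVec, dotProduct_add, hp, hq, Polynomial.eval_add, add_mul]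
    | monomial k a =>
      rw [Polynomial.aeval_monomial, Algebra.algebraMap_eq_smul_one, smul_mul_assoc, one_mul,
        smul_mulVec, dotProduct_smul, hpow k 0 le_rfl, Polynomial.eval_monomial]
      simp [mul_assoc]
  have h := hpoly A.charpoly
  rw [Matrix.aeval_self_charpoly, zero_mulVec, dotProduct_zero, eq_comm, mul_eq_zero] at h
  exact mem_spectrum_iff_isRoot_charpoly.2 (h.resolve_right hκ)

/-- The Schur complement of the block `sI - A` is the scalar `-cᵀ(sI - A)⁻¹b`. -/
theorem isUnit_rosenbrock {A : Matrix (Fin n) (Fin n) ℝ} {b c : Fin n → ℝ} {s : ℝ}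
    (hu : IsUnit (s • (1 : Matrix (Fin n) (Fin n) ℝ) - A))
    (hne : c ⬝ᵥ ((s • (1 : Matrix (Fin n) (Fin n) ℝ) - A)⁻¹ *ᵥ b) ≠ 0) :
    IsUnit (rosenbrock A b c s) := by
  have hdet := (isUnit_iff_isUnit_det _).1 hu
  let := invertibleOfIsUnitDet _ hdet
  rw [isUnit_iff_isUnit_det, rosenbrock, det_fromBlocks₁₁, invOf_eq_nonsing_inv]
  refine hdet.mul (isUnit_iff_ne_zero.2 ?_)
  rw [det_unique, zero_sub, neg_apply, neg_ne_zero, Matrix.mul_assoc]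
  exact hne

theorem not_isUndetectable_exp {A : Matrix (Fin n) (Fin n) ℝ} {b c : Fin n → ℝ} {s d₀ : ℝ}
    (hu : IsUnit (s • (1 : Matrix (Fin n) (Fin n) ℝ) - A))
    (hne : c ⬝ᵥ ((s • (1 : Matrix (Fin n) (Fin n) ℝ) - A)⁻¹ *ᵥ b) ≠ 0) (hd : d₀ ≠ 0) :
    ¬ IsUndetectable A b c (fun t => -(Real.exp (s * t) * d₀)) := by
  rintro ⟨_, _, x, _, hx, hc⟩
  set v := (s • (1 : Matrix (Fin n) (Fin n) ℝ) - A)⁻¹ *ᵥ b with hv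
  have hAv : A *ᵥ v = s • v - b := by
    have h : (s • (1 : Matrix (Fin n) (Fin n) ℝ) - A) *ᵥ v = b := by
      rw [hv, mulVec_mulVec, mul_nonsing_inv _ ((isUnit_iff_isUnit_det _).1 hu), one_mulVec]
    rw [sub_mulVec, smul_mulVec, one_mulVec] at h
    rw [← h, sub_sub_cancel]
  -- Adding `exp(st) d₀ v` to the state cancels the input, leaving a solution of `ẇ = A w` whose
  -- output is `d₀ (cᵀv) exp(st)`.
  have hs : s ∈ spectrum ℝ A := by
    refine mem_spectrum_of_output_eq_exp A c (w := fun t => x t + (Real.exp (s * t) * d₀) • v)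
      (mul_ne_zero hd hne) (fun t ht => ?_) fun t ht => ?_
    · have he : HasDerivAt (fun t : ℝ => Real.exp (s * t) * d₀)
          (Real.exp (s * t) * (s * 1) * d₀) t :=
        (((hasDerivAt_id t).const_mul s).exp).mul_const d₀
      refine ((hx t ht).add (he.smul_const v).hasDerivWithinAt).congr_deriv ?_
      rw [mulVec_add, mulVec_smul, hAv]
      module
    · rw [dotProduct_add, hc t ht, dotProduct_smul, smul_eq_mul]
      ring
  rw [← Algebra.algebraMap_eq_smul_one] at hu
  exact hs hu

theorem blocksAttacks_of_transfer_pos {A : Matrix (Fin n) (Fin n) ℝ} {b c : Fin n → ℝ}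
    (h : ∀ s : ℝ, 0 ≤ s → IsUnit (s • (1 : Matrix (Fin n) (Fin n) ℝ) - A) ∧
      0 < c ⬝ᵥ ((s • (1 : Matrix (Fin n) (Fin n) ℝ) - A)⁻¹ *ᵥ b)) : BlocksAttacks A b c where
  successful := fun s hs => Or.inl <| by
    rw [rank_of_isUnit _ (isUnit_rosenbrock (h s hs).1 (h s hs).2.ne')]
    simp
  transfer_pos := h
  no_undetectable := fun s _ hs hd => not_isUndetectable_exp (h s hs).1 (h s hs).2.ne' hd

end ZeroDynamics

/-! ### Strict positivity of the pairing with the dual cone -/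

section Dual

variable {n : ℕ}

theorem dotProduct_pos_of_mem_interior_dualCone {K : Set (Fin n → ℝ)} {y z : Fin n → ℝ}
    (hy : y ∈ interior (dualCone K)) (hz : z ∈ K) (hz0 : z ≠ 0) : 0 < y ⬝ᵥ z := by
  let f : (Fin n → ℝ) →L[ℝ] ℝ := LinearMap.toContinuousLinearMap (dotProductBilin ℝ ℝ z)
  have hf : ∀ v, f v = z ⬝ᵥ v := fun v => rfl
  have hf0 : f ≠ 0 := fun h => hz0 <| dotProduct_self_eq_zero.1 <| by rw [← hf, h]; rfl
  refine lt_of_le_of_ne (by rw [dotProduct_comm]; exact interior_subset hy z hz) fun h => ?_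
  exact notMem_interior_of_functional_eq_zero hf0 (K := dualCone K) (fun x hx => (hx : ∀ w ∈ K, 0 ≤ w ⬝ᵥ x) z hz)
    (by rw [hf, dotProduct_comm, ← h]) hy

theorem dotProduct_pos_of_mem_interior {K : Set (Fin n → ℝ)} {y z : Fin n → ℝ}
    (hy : y ∈ dualCone K) (hy0 : y ≠ 0) (hz : z ∈ interior K) : 0 < y ⬝ᵥ z := by
  let f : (Fin n → ℝ) →L[ℝ] ℝ := LinearMap.toContinuousLinearMap (dotProductBilin ℝ ℝ y)
  have hf : ∀ v, f v = y ⬝ᵥ v := fun v => rfl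
  have hf0 : f ≠ 0 := fun h => hy0 <| dotProduct_self_eq_zero.1 <| by rw [← hf, h]; rfl
  have hfK : ∀ x ∈ K, 0 ≤ f x := fun x hx => by rw [hf, dotProduct_comm]; exact hy x hx
  refine lt_of_le_of_ne (hfK z (interior_subset hz)) fun h => ?_
  exact notMem_interior_of_functional_eq_zero hf0 hfK h.symm hz

end Dual

/-! ### The main theorem -/

theorem mainTheorem1 {n : ℕ} (K : ProperCone ℝ (Fin n → ℝ)) (hK : IsPointedSolid K)
    (A : Matrix (Fin n) (Fin n) ℝ) (b c : Fin n → ℝ)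
    (hstable : IsHurwitz A) (hinv : IsConeInvariantSystem K A b c) :
    (∀ i j : Fin n, (Pi.single i 1 : Fin n → ℝ) ∈ K →
      (Pi.single j 1 : Fin n → ℝ) ∈ interior (dualCone (K : Set (Fin n → ℝ))) →
      BlocksAttacks A (Pi.single i 1) (Pi.single j 1)) ∧
    (IsConeIrreducible K A →
      (∀ i j : Fin n, (Pi.single i 1 : Fin n → ℝ) ∈ K →
        (Pi.single j 1 : Fin n → ℝ) ∈ dualCone (K : Set (Fin n → ℝ)) →
        BlocksAttacks A (Pi.single i 1) (Pi.single j 1)) ∧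
      ∀ s : ℝ, 0 ≤ s →
        IsUnit (s • (1 : Matrix (Fin n) (Fin n) ℝ) - A) ∧
        IsConePositive K (s • (1 : Matrix (Fin n) (Fin n) ℝ) - A)⁻¹) := by
  set T : (Fin n → ℝ) →L[ℝ] (Fin n → ℝ) := LinearMap.toContinuousLinearMap A.mulVecLin
  have hT : ∀ v, T v = A *ᵥ v := fun v => rfl
  have hunit : ∀ s : ℝ, 0 ≤ s → IsUnit (s • (1 : Matrix (Fin n) (Fin n) ℝ) - A) :=
    fun s hs => isUnit_smul_one_sub_of_isHurwitz hstable hs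
  have hflow : ∀ x ∈ K, ∀ t : ℝ, 0 ≤ t → NormedSpace.exp (t • T) x ∈ K := fun x hx t ht =>
    (hinv (fun _ => 0) (fun t => NormedSpace.exp (t • T) x) continuousOn_const (fun _ _ => le_rfl)
      (fun t _ => by
        simpa [hT] using (hasDerivAt_exp_smul_apply' T x t).hasDerivWithinAt (s := Ici 0))
      (by simpa using hx) t ht).1
  have hsolve : ∀ s : ℝ, 0 ≤ s → ∀ x : Fin n → ℝ,
      s • ((s • (1 : Matrix (Fin n) (Fin n) ℝ) - A)⁻¹ *ᵥ x) -
        T ((s • (1 : Matrix (Fin n) (Fin n) ℝ) - A)⁻¹ *ᵥ x) = x := fun s hs x => by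
    have h : (s • (1 : Matrix (Fin n) (Fin n) ℝ) - A) *ᵥ
        ((s • (1 : Matrix (Fin n) (Fin n) ℝ) - A)⁻¹ *ᵥ x) = x := by
      rw [mulVec_mulVec, mul_nonsing_inv _ ((isUnit_iff_isUnit_det _).1 (hunit s hs)), one_mulVec]
    rwa [sub_mulVec, smul_mulVec, one_mulVec] at h
  have hres : ∀ s : ℝ, 0 ≤ s → ∀ x, ∃ z, s • z - T z = x := fun s hs x => ⟨_, hsolve s hs x⟩
  have hinj : ∀ s : ℝ, 0 ≤ s → ∀ z, T z = s • z → z = 0 := fun s hs z hz =>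
    mulVec_injective_iff_isUnit.2 (hunit s hs) <| by
      simp only [sub_mulVec, smul_mulVec, one_mulVec, mulVec_zero, ← hT, hz, sub_self]
  have hmem : ∀ s : ℝ, 0 ≤ s → ∀ x ∈ K, (s • (1 : Matrix (Fin n) (Fin n) ℝ) - A)⁻¹ *ᵥ x ∈ K :=
    fun s hs x hx => resolvent_mem_cone K T hflow hres hinj hs hx (hsolve s hs x)
  have hsingle : ∀ i : Fin n, (Pi.single i 1 : Fin n → ℝ) ≠ 0 := fun i h => by
    simpa using congrFun h i
  refine ⟨fun i j hi hj => blocksAttacks_of_transfer_pos fun s hs => ⟨hunit s hs,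
    dotProduct_pos_of_mem_interior_dualCone hj (hmem s hs _ hi) fun h0 => hsingle i ?_⟩,
    fun hirr => ?_⟩
  · rw [← hsolve s hs (Pi.single i 1), h0, smul_zero, map_zero, sub_zero]
  have hint : ∀ s : ℝ, 0 ≤ s → ∀ x ∈ K, x ≠ 0 →
      (s • (1 : Matrix (Fin n) (Fin n) ℝ) - A)⁻¹ *ᵥ x ∈ interior (K : Set (Fin n → ℝ)) :=
    fun s hs x hx hx0 => resolvent_mem_interior_cone K T hK.pointed hK.solid hflow hres hinj
      (fun z r hz0 hz => hirr.no_boundary_eigenvector z r hz0 hz) hs hx hx0 (hsolve s hs x)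
  exact ⟨fun i j hi hj => blocksAttacks_of_transfer_pos fun s hs => ⟨hunit s hs,
      dotProduct_pos_of_mem_interior hj (hsingle j) (hint s hs _ hi (hsingle i))⟩,
    fun s hs => ⟨hunit s hs, hmem s hs, hint s hs⟩⟩
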